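/- **Conventions.** A topology $\mathcal S$ on a set $X$ has the specialization order $x\le_{\mathcal S} y\iff x\in\overline{\{y\}}$; it is *compatible* with an order $\le$ on $X$ if $\le$ equals $\le_{\mathcal S}$. ${\uparrow}x$ and ${\uparrow}Y$ denote principal filters and up-closures. A set $D$ is *filtered* if it is nonempty and any two members of $D$ have a lower bound in $D$; directed sets are defined dually. With respect to the specialization order, a space is a *web space* if each point $x$ has a neighborhood base of sets $W$ such that $x\in W$ and each $y\in W$ has with $x$ a common lower bound in $W$; a *wide web space* if each point has a neighborhood base of filtered sets; a *core space* if each point has a neighborhood base of sets of the form ${\uparrow}u$. *Sober* means T$_0$ and every irreducible closed set is the closure of a point. *Locally compact* means that each point has a neighborhood base of compact sets (no separation axiom is included). The *weak patch space* of $(X,\mathcal S)$ is $\mathrm P_\upsilon(X,\mathcal S)=(X,\le_{\mathcal S},\mathcal S^\upsilon)$, where $\mathcal S^\upsilon$ is generated by $\mathcal S$ and the sets $X\setminus{\uparrow}x$, $x\in X$. A *semilattice-ordered space* $S=(X,\le,\mathcal T)$ is a meet-semilattice $(X,\le)$ with a topology $\mathcal T$ (a priori unrelated to $\le$). Its *upper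 space* $\mathrm US$ carries the topology of all open upper sets. $S$ is *compatible* if $\mathcal T$ is compatible with $\le$; *T$_1$-ordered* (a *T$_1$-semilattice*) if all principal ideals and all principal filters are closed; *hyperconvex* if $\mathcal T$ is generated by the open upper sets and the complements of principal filters; *mc-ordered* if every directed subset, regarded as a net, has a supremum to which it converges; a *fan space* if it is T$_1$-ordered, ${\uparrow}O$ is open for each open $O$, and each point has a neighborhood base of nonempty sets ${\uparrow}u\setminus{\uparrow}F$ with $F$ finite; *semitopological* if all maps $y\mapsto x\wedge y$ are continuous; *topological* if $\wedge$ is jointly continuous; *s-topological* if it is topological and each point has a neighborhood base of subsemilattices. A *continuous semilattice* is a meet-semilattice that is a continuous domain, i.e. every directed subset has a join, and for each element $x$ there is a least ideal having a join above $x$. Its *Scott space* carries the Scott topology, its *Lawson space* the topology generated by the Scott topology and the complements of principal filters. **Statement.** For a semilattice-ordered space $S$, the following are equivalent: * $S$ is the weak patch space of a sober core space; * $S$ is an mc-ordered fan space; * $S$ is a hyperconvex, mc-ordered, s-topological T$_1$-semilattice with locally compact upper space $\mathrm US$; * $S$ is the Lawson space of a continuous semilattice. In this case the sober core space in the first condition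 is unique. Moreover, the weak patch functor $\mathrm P_\upsilon$ induces concrete isomorphisms between 1. the category of compatible semitopological semilattices (equivalently, compatible semilattice-ordered web spaces) and that of hyperconvex semitopological T$_1$-semilattices; 2. the category of compatible s-topological semilattices (equivalently, compatible semilattice-ordered wide web spaces) and that of hyperconvex s-topological T$_1$-semilattices; 3. the category of locally compact compatible s-topological semilattices (equivalently, compatible semilattice-ordered core spaces) and that of topological semilattices that are fan spaces; 4. the category of Scott spaces of continuous semilattices (equivalently, compatible semilattice-ordered sober core spaces) and that of Lawson spaces of continuous semilattices (equivalently, mc-ordered topological semilattices that are fan spaces). A concrete isomorphism is an isomorphism of categories commuting with the forgetful functors to sets. The statement holds for each of the following choices of morphisms: (a) continuous maps in the first category and isotone lower semicontinuous maps (preimages of closed lower sets are closed) in the second; (b) $\upsilon$-proper maps (continuous maps for which preimages of sets closed in the weak lower topology, generated by the complements of principal filters, are closed in the weak patch topology) in the first category and isotone continuous maps in the second; and likewise when all morphisms in (a) or (b) are moreover required to preserve binary meets. -/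

import Mathlib

open Set Filter Topology CategoryTheory

universe u

namespace SemilatSpace

section Spaces

variable {X : Type u}

/-- Every point has a base of neighborhoods `N` satisfying `B x N`. -/
def HasNhdBase (t : TopologicalSpace X) (B : X → Set X → Prop) : Prop :=
  ∀ (x : X) (O : Set X), IsOpen[t] O → x ∈ O → ∃ N, B x N ∧ N ∈ @nhds X t x ∧ N ⊆ O

/-- A (down-)filtered set: nonempty, and any two members have a lower bound in the set. -/
def IsFilteredSet [Preorder X] (D : Set X) : Prop :=
  D.Nonempty ∧ DirectedOn (· ≥ ·) D

/-- A web around `x`. -/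
def IsWebAround [Preorder X] (x : X) (W : Set X) : Prop :=
  x ∈ W ∧ ∀ y ∈ W, ∃ z ∈ W, z ≤ x ∧ z ≤ y

/-! ### Spaces with their specialization order (`x ≤ y` iff `x` lies in the closure of `{y}`) -/

/-- Web spaces: neighborhood bases of webs. -/
def IsWebSpace (t : TopologicalSpace X) : Prop :=
  HasNhdBase t fun x W => @IsWebAround X (@specializationPreorder X t) x W

/-- Wide web spaces: neighborhood bases of filtered sets. -/
def IsWideWebSpace (t : TopologicalSpace X) : Prop :=
  HasNhdBase t fun _ D => @IsFilteredSet X (@specializationPreorder X t) D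

/-- Core spaces: neighborhood bases of cores, i.e. of principal filters `↑u`. -/
def IsCoreSpace (t : TopologicalSpace X) : Prop :=
  HasNhdBase t fun _ C => ∃ u, C = @Ici X (@specializationPreorder X t) u

/-- Sober spaces: T₀, and every irreducible closed set is a point closure. -/
def IsSober (t : TopologicalSpace X) : Prop :=
  @T0Space X t ∧ @QuasiSober X t

/-- The weak patch topology, generated by `t` and the complements of all cores
(in Mathlib's order of topologies the join of two topologies is their `⊓`). -/
abbrev weakPatch (t : TopologicalSpace X) : TopologicalSpace X :=
  t ⊓ @Topology.lower X (@specializationPreorder X t)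

/-! ### Ordered spaces: a set with an order and a topology `t`, a priori unrelated -/

/-- The topology is compatible with the order: the order is the specialization order. -/
def IsCompatible [Preorder X] (t : TopologicalSpace X) : Prop :=
  ∀ x y : X, x ≤ y ↔ x ∈ @closure X t {y}

/-- `(X, ≤, t)` is the weak patch space of `(X, s)`. -/
def IsWeakPatchSpaceOf [Preorder X] (t s : TopologicalSpace X) : Prop :=
  IsCompatible s ∧ t = weakPatch s

/-- The topology of the upper space: its open sets are the `t`-open upper sets. -/
abbrev upperSpace [Preorder X] (t : TopologicalSpace X) : TopologicalSpace X :=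
  t ⊔ Topology.upperSet X

/-- T₁-ordered spaces (semi-pospaces): principal ideals and principal filters are closed. -/
def IsT1Ordered [PartialOrder X] (t : TopologicalSpace X) : Prop :=
  (∀ x : X, IsClosed[t] (Iic x)) ∧ (∀ x : X, IsClosed[t] (Ici x))

/-- Upwards stable: up-closures of open sets are open. -/
def IsUpStable [Preorder X] (t : TopologicalSpace X) : Prop :=
  ∀ O : Set X, IsOpen[t] O → IsOpen[t] (upperClosure O : Set X)

/-- Hyperconvex: the topology is generated by the open upper sets and the complements of
principal filters. -/
def IsHyperconvex [Preorder X] (t : TopologicalSpace X) : Prop :=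
  t = TopologicalSpace.generateFrom
    ({U | IsOpen[t] U ∧ IsUpperSet U} ∪ {V | ∃ x : X, V = (Ici x)ᶜ})

/-- Fans: nonempty sets `↑u \ ↑F` with `F` finite. -/
def IsFan [Preorder X] (A : Set X) : Prop :=
  A.Nonempty ∧ ∃ (u : X) (F : Set X), F.Finite ∧ A = Ici u \ (upperClosure F : Set X)

/-- (Ordered) fan spaces: upwards stable semi-pospaces with neighborhood bases of fans. -/
def IsFanSpace [PartialOrder X] (t : TopologicalSpace X) : Prop :=
  IsUpStable t ∧ IsT1Ordered t ∧ HasNhdBase t fun _ A => IsFan A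

/-- mc-ordered: every directed subset, regarded as a net, has a supremum to which it
converges. -/
def IsMcOrdered [PartialOrder X] (t : TopologicalSpace X) : Prop :=
  ∀ D : Set X, D.Nonempty → DirectedOn (· ≤ ·) D →
    ∃ a, IsLUB D a ∧ Tendsto (Subtype.val : D → X) atTop (@nhds X t a)

/-- Semitopological semilattices: the unary meet operations are continuous. -/
def IsSemitopological [SemilatticeInf X] (t : TopologicalSpace X) : Prop :=
  ∀ x : X, @Continuous X X t t fun y => x ⊓ y

/-- Topological semilattices: the binary meet operation is jointly continuous. -/
def IsTopologicalSemilattice [SemilatticeInf X] (t : TopologicalSpace X) : Prop :=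
  @ContinuousInf X t _

/-- s-topological semilattices: topological semilattices with small semilattices, i.e. each
point has a neighborhood base of subsemilattices. -/
def IsSTopological [SemilatticeInf X] (t : TopologicalSpace X) : Prop :=
  IsTopologicalSemilattice t ∧ HasNhdBase t fun _ N => InfClosed N

/-! ### Continuous domains -/

/-- Continuous domains: posets in which every directed subset has a join (up-completeness),
and for each `x` there is a least ideal having a join above `x` (continuity). -/
def IsContinuousDomain (X : Type u) [PartialOrder X] : Prop :=
  (∀ D : Set X, D.Nonempty → DirectedOn (· ≤ ·) D → ∃ a, IsLUB D a) ∧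
  ∀ x : X, ∃ I : Order.Ideal X,
    IsLeast {J : Order.Ideal X | ∃ a, IsLUB (J : Set X) a ∧ x ≤ a} I

/-- `(X, ≤, t)` is the Scott space of a continuous domain. -/
def IsScottSpaceOfContinuousDomain [PartialOrder X] (t : TopologicalSpace X) : Prop :=
  IsContinuousDomain X ∧ t = Topology.scott X univ

/-- `(X, ≤, t)` is the Lawson space of a continuous domain. -/
def IsLawsonSpaceOfContinuousDomain [PartialOrder X] (t : TopologicalSpace X) : Prop :=
  IsContinuousDomain X ∧ t = Topology.lawson X

end Spaces

/-! ### Semilattice-ordered spaces and their categories -/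

/-- A semilattice-ordered space: a meet-semilattice equipped with a topology. -/
structure SLSpace : Type (u + 1) where
  carrier : Type u
  semilattice : SemilatticeInf carrier
  top : TopologicalSpace carrier

attribute [instance] SLSpace.semilattice

/-- The weak patch space of a compatible semilattice-ordered space. (For a compatible space the
given order is the specialization order; the construction is only used for such spaces.) -/
def SLSpace.weakPatchSpace (S : SLSpace.{u}) : SLSpace.{u} :=
  ⟨S.carrier, S.semilattice, weakPatch S.top⟩

/-- A class of maps between semilattice-ordered spaces that can serve as morphisms. -/
structure MapClass where
  mem : ∀ S T : SLSpace.{u}, (S.carrier → T.carrier) → Prop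
  id_mem : ∀ S : SLSpace.{u}, mem S S id
  comp_mem : ∀ {S T U : SLSpace.{u}} {f : S.carrier → T.carrier} {g : T.carrier → U.carrier},
    mem S T f → mem T U g → mem S U (g ∘ f)

/-- Continuous maps. -/
def MapClass.continuous : MapClass.{u} where
  mem S T f := @Continuous _ _ S.top T.top f
  id_mem S := @continuous_id _ S.top
  comp_mem {S T U _ _} hf hg := @Continuous.comp _ _ _ S.top T.top U.top _ _ hg hf

/-- υ-proper maps: continuous maps such that preimages of sets that are closed in the weak lower
topology (of the specialization order) are closed in the weak patch topology. -/
def MapClass.proper : MapClass.{u} where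
  mem S T f := @Continuous _ _ S.top T.top f ∧
    ∀ C, IsClosed[@Topology.lower _ (@specializationPreorder _ T.top)] C →
      IsClosed[weakPatch S.top] (f ⁻¹' C)
  id_mem S := ⟨@continuous_id _ S.top, fun _ hC => hC.mono inf_le_right⟩
  comp_mem {S T U f g} hf hg := by
    refine ⟨@Continuous.comp _ _ _ S.top T.top U.top _ _ hg.1 hf.1, fun C hC => ?_⟩
    have hp : @Continuous _ _ (weakPatch S.top) (weakPatch T.top) f :=
      continuous_inf_rng.2 ⟨continuous_inf_dom_left hf.1,
        (@continuous_iff_isClosed _ _ (weakPatch S.top) (_) f).2 hf.2⟩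
    exact @IsClosed.preimage _ _ (weakPatch S.top) (weakPatch T.top) _ hp _ (hg.2 C hC)

/-- Isotone lower semicontinuous maps: preimages of closed lower sets are closed. -/
def MapClass.isotoneLSC : MapClass.{u} where
  mem S T f := Monotone f ∧
    ∀ C, IsClosed[T.top] C → IsLowerSet C → IsClosed[S.top] (f ⁻¹' C)
  id_mem _ := ⟨monotone_id, fun _ hC _ => hC⟩
  comp_mem hf hg := ⟨hg.1.comp hf.1, fun C hC hl =>
    hf.2 _ (hg.2 C hC hl) (hl.preimage hg.1)⟩

/-- Isotone continuous maps. -/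
def MapClass.isotoneContinuous : MapClass.{u} where
  mem S T f := Monotone f ∧ @Continuous _ _ S.top T.top f
  id_mem S := ⟨monotone_id, @continuous_id _ S.top⟩
  comp_mem {S T U _ _} hf hg :=
    ⟨hg.1.comp hf.1, @Continuous.comp _ _ _ S.top T.top U.top _ _ hg.2 hf.2⟩

/-- The maps of a given class that are semilattice homomorphisms. -/
def MapClass.hom (M : MapClass.{u}) : MapClass.{u} where
  mem S T f := M.mem S T f ∧ ∀ a b, f (a ⊓ b) = f a ⊓ f b
  id_mem S := ⟨M.id_mem S, fun _ _ => rfl⟩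
  comp_mem hf hg := ⟨M.comp_mem hf.1 hg.1, fun a b => by simp [hf.2, hg.2]⟩

/-- The objects of the category of semilattice-ordered spaces with property `P`, with the maps
in the class `M` as morphisms. -/
structure SLCat (M : MapClass.{u}) (P : SLSpace.{u} → Prop) : Type (u + 1) where
  space : SLSpace.{u}
  property : P space

namespace SLCat

variable {M : MapClass.{u}} {P : SLSpace.{u} → Prop}

/-- Morphisms: maps in the class `M`. -/
@[ext]
structure Hom (A B : SLCat M P) : Type u where
  toFun : A.space.carrier → B.space.carrier
  mem : M.mem A.space B.space toFun

instance : Category.{u} (SLCat M P) where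
  Hom := Hom
  id A := ⟨id, M.id_mem A.space⟩
  comp f g := ⟨g.toFun ∘ f.toFun, M.comp_mem f.mem g.mem⟩

/-- The forgetful functor to sets. -/
def forgetful (M : MapClass.{u}) (P : SLSpace.{u} → Prop) : SLCat M P ⥤ Type u where
  obj A := A.space.carrier
  map f := TypeCat.ofHom (Hom.toFun f)

end SLCat

/-- The weak patch functor induces a concrete isomorphism from the category `SLCat M P` onto the
category `SLCat N Q`: there is an isomorphism of categories which on objects is the weak patch
construction and which commutes with the forgetful functors to sets. -/
def InducesConcreteIso (M N : MapClass.{u}) (P Q : SLSpace.{u} → Prop) : Prop :=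
  ∃ (F : SLCat M P ⥤ SLCat N Q) (G : SLCat N Q ⥤ SLCat M P),
    F ⋙ G = 𝟭 (SLCat M P) ∧ G ⋙ F = 𝟭 (SLCat N Q) ∧
    F ⋙ SLCat.forgetful N Q = SLCat.forgetful M P ∧
    ∀ A : SLCat M P, (F.obj A).space = A.space.weakPatchSpace

/-- The weak patch functor induces concrete isomorphisms between the class `P` of compatible
semilattice-ordered spaces and the class `Q` of semilattice-ordered spaces, for each of the
following choices of morphisms: continuous maps on the one side and isotone lower semicontinuous
maps on the other; υ-proper maps on the one side and isotone continuous maps on the other; and the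
semilattice homomorphisms among these. -/
def WeakPatchIso (P Q : SLSpace.{u} → Prop) : Prop :=
  InducesConcreteIso MapClass.continuous MapClass.isotoneLSC P Q ∧
  InducesConcreteIso MapClass.proper MapClass.isotoneContinuous P Q ∧
  InducesConcreteIso MapClass.continuous.hom MapClass.isotoneLSC.hom P Q ∧
  InducesConcreteIso MapClass.proper.hom MapClass.isotoneContinuous.hom P Q

end SemilatSpace

open SemilatSpace

/-! The weak patch construction is undone by passing to the upper space, and everything rests on the
two round trips. For a compatible web space `s`, the open upper sets of the patch are exactly the
`s`-open sets (`IsCompatible.upperSpace_weakPatch`). Conversely, `t` is the patch of its upper space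
if it is T₁-ordered and hyperconvex, almost by definition, or if it is a fan space. So `s` is
determined by its patch, which gives uniqueness, and the categorical isomorphisms keep underlying
sets, orders and maps fixed.

It remains to match properties. In a compatible semilattice, open sets are upper sets, so continuity
of meets becomes a condition on lower bounds inside neighborhoods: semitopological means web,
s-topological means wide web, and local compactness improves wide webs to cores. These properties
ascend to the patch because meet is also continuous for the weak lower topology, and descend to the
upper space because up-closures of open sets are open.

For core spaces, sobriety amounts to monotone convergence, and then `u` is way below `x` exactly
when `↑u` is a neighborhood of `x`. This identifies sober core spaces with Scott spaces of
continuous domains, hence their patches with Lawson spaces. -/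

namespace SemilatSpace

/-! ### Compatible topologies, upper spaces and weak patches -/

section Order

variable {X : Type u} [PartialOrder X]

lemma IsCompatible.specializationPreorder_eq {s : TopologicalSpace X} (h : IsCompatible s) :
    @specializationPreorder X s = PartialOrder.toPreorder := by
  refine Preorder.ext fun x y => ?_
  rw [h x y]
  exact specializes_iff_mem_closure

lemma IsCompatible.isUpperSet {s : TopologicalSpace X} (h : IsCompatible s) {U : Set X}
    (hU : IsOpen[s] U) : IsUpperSet U := fun x y hxy hx =>
  (specializes_iff_mem_closure.2 ((h x y).1 hxy)).mem_open hU hx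

lemma IsCompatible.le_of_forall_isOpen {s : TopologicalSpace X} (h : IsCompatible s) {x y : X}
    (H : ∀ U, IsOpen[s] U → x ∈ U → y ∈ U) : x ≤ y :=
  (h x y).2 (mem_closure_iff.2 fun U hU hx => ⟨y, H U hU hx, rfl⟩)

lemma IsCompatible.isClosed_Iic {s : TopologicalSpace X} (h : IsCompatible s) (x : X) :
    IsClosed[s] (Iic x) := by
  have : Iic x = @closure X s {x} := Set.ext fun y => h y x
  rw [this]
  exact isClosed_closure

lemma IsCompatible.mem_nhds_mono {s : TopologicalSpace X} (h : IsCompatible s) {x y : X}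
    {N : Set X} (hN : N ∈ @nhds X s x) (hxy : x ≤ y) : N ∈ @nhds X s y :=
  (specializes_iff_mem_closure.2 ((h x y).1 hxy)) hN

lemma IsCompatible.weakPatch_eq {s : TopologicalSpace X} (h : IsCompatible s) :
    weakPatch s = s ⊓ Topology.lower X := by
  rw [weakPatch, h.specializationPreorder_eq]

lemma IsCompatible.isWebSpace_iff {s : TopologicalSpace X} (h : IsCompatible s) :
    IsWebSpace s ↔ HasNhdBase s IsWebAround := by
  rw [IsWebSpace, h.specializationPreorder_eq]

lemma IsCompatible.isWideWebSpace_iff {s : TopologicalSpace X} (h : IsCompatible s) :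
    IsWideWebSpace s ↔ HasNhdBase s fun _ D => IsFilteredSet D := by
  rw [IsWideWebSpace, h.specializationPreorder_eq]

lemma IsCompatible.isCoreSpace_iff {s : TopologicalSpace X} (h : IsCompatible s) :
    IsCoreSpace s ↔
      ∀ (x : X) (O : Set X), IsOpen[s] O → x ∈ O → ∃ u ∈ O, Ici u ∈ @nhds X s x := by
  rw [IsCoreSpace, h.specializationPreorder_eq]
  refine forall₄_congr fun x O hO hx => ?_
  constructor
  · rintro ⟨_, ⟨u, rfl⟩, hu, huO⟩
    exact ⟨u, huO self_mem_Ici, hu⟩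
  · rintro ⟨u, hu, hux⟩
    exact ⟨_, ⟨u, rfl⟩, hux, (h.isUpperSet hO).Ici_subset hu⟩

lemma mem_nhds_inf_lower_iff {s : TopologicalSpace X} {x : X} {N : Set X} :
    N ∈ @nhds X (s ⊓ Topology.lower X) x ↔ ∃ U, IsOpen[s] U ∧ x ∈ U ∧
      ∃ F : Set X, F.Finite ∧ x ∉ (upperClosure F : Set X) ∧
        U \ (upperClosure F : Set X) ⊆ N := by
  have hb := @TopologicalSpace.IsTopologicalBasis.nhds_hasBasis X (Topology.lower X) _
    (@Topology.IsLower.isTopologicalBasis X _ (Topology.lower X)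
      (@Topology.IsLower.mk X (Topology.lower X) _ rfl)) x
  rw [nhds_inf, ((@nhds_basis_opens X s x).inf hb).mem_iff]
  constructor
  · rintro ⟨⟨U, V⟩, ⟨⟨hx, hU⟩, ⟨F, hF, rfl⟩, hxF⟩, h⟩
    exact ⟨U, hU, hx, F, hF, hxF, h⟩
  · rintro ⟨U, hU, hx, F, hF, hxF, h⟩
    exact ⟨⟨U, _⟩, ⟨⟨hx, hU⟩, ⟨F, hF, rfl⟩, hxF⟩, h⟩

lemma isOpen_upperSpace_iff {t : TopologicalSpace X} {U : Set X} :
    IsOpen[upperSpace t] U ↔ IsOpen[t] U ∧ IsUpperSet U := Iff.rfl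

lemma isClosed_upperSpace_iff {t : TopologicalSpace X} {C : Set X} :
    IsClosed[upperSpace t] C ↔ IsClosed[t] C ∧ IsLowerSet C := by
  rw [← @isOpen_compl_iff _ _ (upperSpace t), isOpen_upperSpace_iff, isUpperSet_compl,
    @isOpen_compl_iff _ _ t]

lemma isClosed_lower_Ici (x : X) : IsClosed[Topology.lower X] (Ici x) :=
  @IsClosed.mk X (Topology.lower X) _ (.basic _ ⟨x, rfl⟩)

lemma IsT1Ordered.isCompatible_upperSpace {t : TopologicalSpace X} (h : IsT1Ordered t) :
    IsCompatible (upperSpace t) := fun x y => by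
  constructor
  · intro hxy
    exact (@mem_closure_iff X (upperSpace t) _ _).2 fun U hU hx => ⟨y, hU.2 hxy hx, rfl⟩
  · intro hx
    have : IsClosed[upperSpace t] (Iic y) := isClosed_upperSpace_iff.2 ⟨h.1 y, isLowerSet_Iic y⟩
    exact (@closure_minimal X (upperSpace t) _ _ (singleton_subset_iff.2 self_mem_Iic) this) hx

lemma IsHyperconvex.weakPatch_upperSpace {t : TopologicalSpace X} (h : IsHyperconvex t)
    (h1 : IsT1Ordered t) : weakPatch (upperSpace t) = t := by
  rw [h1.isCompatible_upperSpace.weakPatch_eq]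
  apply le_antisymm
  · conv_rhs => rw [h]
    refine le_generateFrom ?_
    rintro U (hU | ⟨x, rfl⟩)
    · exact (inf_le_left : upperSpace t ⊓ Topology.lower X ≤ _) U hU
    · exact (inf_le_right : upperSpace t ⊓ Topology.lower X ≤ _) _
        (isClosed_lower_Ici x).isOpen_compl
  · refine le_inf le_sup_left (le_generateFrom ?_)
    rintro _ ⟨x, rfl⟩
    exact (h1.2 x).isOpen_compl

lemma IsCompatible.isT1Ordered_weakPatch {s : TopologicalSpace X} (h : IsCompatible s) :
    IsT1Ordered (weakPatch s) := by
  rw [h.weakPatch_eq]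
  exact ⟨fun x => (h.isClosed_Iic x).mono inf_le_left, fun x =>
    (isClosed_lower_Ici x).mono inf_le_right⟩

lemma IsCompatible.isHyperconvex_weakPatch {s : TopologicalSpace X} (h : IsCompatible s) :
    IsHyperconvex (weakPatch s) := by
  have h1 := h.isT1Ordered_weakPatch
  apply le_antisymm
  · refine le_generateFrom ?_
    rintro U (hU | ⟨x, rfl⟩)
    · exact hU.1
    · exact (h1.2 x).isOpen_compl
  · conv_rhs => rw [h.weakPatch_eq]
    refine le_inf (fun U hU => .basic _ (Or.inl ⟨?_, h.isUpperSet hU⟩)) (le_generateFrom ?_)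
    · exact (inf_le_left : weakPatch s ≤ s) U hU
    · rintro _ ⟨x, rfl⟩
      exact .basic _ (Or.inr ⟨x, rfl⟩)

/-- A compatible web space is the upper space of its weak patch space. -/
lemma IsCompatible.upperSpace_weakPatch {s : TopologicalSpace X} (h : IsCompatible s)
    (hw : IsWebSpace s) : upperSpace (weakPatch s) = s := by
  rw [h.isWebSpace_iff] at hw
  apply le_antisymm
  · exact fun U hU => ⟨(inf_le_left : weakPatch s ≤ s) U hU, h.isUpperSet hU⟩
  · rintro O ⟨hO, hup⟩
    change IsOpen[weakPatch s] O at hO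
    rw [h.weakPatch_eq] at hO
    refine (@isOpen_iff_mem_nhds X s O).2 fun x hx => ?_
    obtain ⟨U, hU, hxU, F, -, hxF, hUF⟩ := mem_nhds_inf_lower_iff.1
      (@IsOpen.mem_nhds X (s ⊓ Topology.lower X) x O hO hx)
    obtain ⟨W, hW, hWx, hWU⟩ := hw x U hU hxU
    refine mem_of_superset hWx fun y hy => ?_
    -- Since `z ≤ x` and `x ∉ ↑F`, also `z ∉ ↑F`, so `z ∈ O`. As `O` is an upper set and `z ≤ y`, it
    -- contains `y`.
    obtain ⟨z, hz, hzx, hzy⟩ := hW.2 y hy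
    exact hup hzy (hUF ⟨hWU hz, fun hzF => hxF ((upperClosure F).upper hzx hzF)⟩)

lemma IsCompatible.isWideWebSpace_of_isCoreSpace {s : TopologicalSpace X} (h : IsCompatible s)
    (hc : IsCoreSpace s) : IsWideWebSpace s := by
  rw [h.isCoreSpace_iff] at hc
  rw [h.isWideWebSpace_iff]
  intro x O hO hx
  obtain ⟨u, hu, hux⟩ := hc x O hO hx
  exact ⟨Ici u, ⟨⟨u, self_mem_Ici⟩, fun a ha b hb => ⟨u, self_mem_Ici, ha, hb⟩⟩, hux,
    (h.isUpperSet hO).Ici_subset hu⟩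

lemma IsCompatible.isWebSpace_of_isWideWebSpace {s : TopologicalSpace X} (h : IsCompatible s)
    (hc : IsWideWebSpace s) : IsWebSpace s := by
  rw [h.isWideWebSpace_iff] at hc
  rw [h.isWebSpace_iff]
  intro x O hO hx
  obtain ⟨D, hD, hDx, hDO⟩ := hc x O hO hx
  refine ⟨D, ⟨mem_of_mem_nhds hDx, fun y hy => ?_⟩, hDx, hDO⟩
  obtain ⟨z, hz, h1, h2⟩ := hD.2 x (mem_of_mem_nhds hDx) y hy
  exact ⟨z, hz, h1, h2⟩

lemma IsCompatible.isWebSpace_of_isCoreSpace {s : TopologicalSpace X} (h : IsCompatible s)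
    (hc : IsCoreSpace s) : IsWebSpace s :=
  h.isWebSpace_of_isWideWebSpace (h.isWideWebSpace_of_isCoreSpace hc)

lemma IsCompatible.locallyCompactSpace_of_isCoreSpace {s : TopologicalSpace X}
    (h : IsCompatible s) (hc : IsCoreSpace s) : LocallyCompactSpace X := by
  rw [h.isCoreSpace_iff] at hc
  refine ⟨fun x N hN => ?_⟩
  obtain ⟨u, hu, hux⟩ := hc x (interior N) isOpen_interior (mem_interior_iff_mem_nhds.2 hN)
  refine ⟨Ici u, hux, ((h.isUpperSet isOpen_interior).Ici_subset hu).trans interior_subset, ?_⟩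
  refine isCompact_of_finite_subcover fun {ι} V hV hc => ?_
  -- One member of the cover suffices: being an upper set, it contains all of `↑u` once it contains
  -- `u`.
  obtain ⟨i, hi⟩ := mem_iUnion.1 (hc self_mem_Ici)
  refine ⟨{i}, ?_⟩
  simpa using (h.isUpperSet (hV i)).Ici_subset hi

/-! ### Monotone convergence and sobriety -/

lemma IsMcOrdered.mono {s t : TopologicalSpace X} (hst : s ≤ t) (h : IsMcOrdered s) :
    IsMcOrdered t := fun D hD hd => by
  obtain ⟨a, ha, hl⟩ := h D hD hd
  exact ⟨a, ha, hl.mono_right (nhds_mono hst)⟩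

lemma IsMcOrdered.exists_mem {s : TopologicalSpace X} (h : IsMcOrdered s) {D : Set X}
    (hD : D.Nonempty) (hd : DirectedOn (· ≤ ·) D) {a : X} (ha : IsLUB D a) {N : Set X}
    (hN : N ∈ @nhds X s a) : ∃ d ∈ D, d ∈ N := by
  obtain ⟨b, hb, hl⟩ := h D hD hd
  obtain rfl := ha.unique hb
  have : Nonempty D := hD.to_subtype
  have : IsDirectedOrder D := directedOn_univ_iff.1 <| by
    rintro ⟨x, hx⟩ - ⟨y, hy⟩ -
    obtain ⟨z, hz, h1, h2⟩ := hd x hx y hy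
    exact ⟨⟨z, hz⟩, trivial, h1, h2⟩
  obtain ⟨d, hdN⟩ := (hl.eventually_mem hN).exists
  exact ⟨d, d.2, hdN⟩

lemma tendsto_of_forall_exists_mem {s : TopologicalSpace X} (h : IsCompatible s) {D : Set X}
    {a : X} (H : ∀ U, IsOpen[s] U → a ∈ U → ∃ d ∈ D, d ∈ U) :
    Tendsto (Subtype.val : D → X) atTop (𝓝 a) := by
  refine tendsto_nhds.2 fun U hU ha => ?_
  obtain ⟨d, hd, hdU⟩ := H U hU ha
  exact mem_of_superset (Ici_mem_atTop (⟨d, hd⟩ : D)) fun e he => h.isUpperSet hU he hdU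

/-- The generic point of an irreducible closed `C` is the supremum of the set `D` of all `u` whose
core `↑u` is a neighborhood of some point of `C`. Irreducibility and the core property make `D`
directed, convergence keeps the supremum in `C`, and cores approximate every point of `C` from below
by members of `D`. -/
lemma IsCompatible.isSober_of_isMcOrdered {s : TopologicalSpace X} (h : IsCompatible s)
    (hc : IsCoreSpace s) (hm : IsMcOrdered s) : IsSober s := by
  rw [h.isCoreSpace_iff] at hc
  refine ⟨⟨fun x y hxy => le_antisymm ?_ ?_⟩, ⟨fun {C} hC hcl => ?_⟩⟩
  · exact h.le_of_forall_isOpen fun U hU hx => (hxy.mem_open_iff hU).1 hx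
  · exact h.le_of_forall_isOpen fun U hU hx => (hxy.mem_open_iff hU).2 hx
  · set D : Set X := {u | ∃ c ∈ C, Ici u ∈ 𝓝 c}
    have hlow : IsLowerSet C := isUpperSet_compl.1 (h.isUpperSet hcl.isOpen_compl)
    have hDC : D ⊆ C := fun u ⟨c, hcC, hu⟩ => hlow (mem_of_mem_nhds hu) hcC
    have hDne : D.Nonempty := by
      obtain ⟨c, hcC⟩ := hC.nonempty
      obtain ⟨u, -, hu⟩ := hc c univ isOpen_univ trivial
      exact ⟨u, c, hcC, hu⟩
    have hDd : DirectedOn (· ≤ ·) D := by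
      rintro u ⟨c, hcC, hu⟩ v ⟨d, hdC, hv⟩
      obtain ⟨e, heC, heu, hev⟩ := hC.isPreirreducible (interior (Ici u)) (interior (Ici v))
        isOpen_interior isOpen_interior ⟨c, hcC, mem_interior_iff_mem_nhds.2 hu⟩
        ⟨d, hdC, mem_interior_iff_mem_nhds.2 hv⟩
      obtain ⟨w, hw, hwe⟩ := hc e _ (isOpen_interior.inter isOpen_interior) ⟨heu, hev⟩
      exact ⟨w, ⟨e, heC, hwe⟩, interior_subset hw.1, interior_subset hw.2⟩
    obtain ⟨a, ha, -⟩ := hm D hDne hDd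
    have haC : a ∈ C := by
      by_contra haC
      obtain ⟨d, hd, hdC⟩ := hm.exists_mem hDne hDd ha (hcl.isOpen_compl.mem_nhds haC)
      exact hdC (hDC hd)
    refine ⟨a, ?_⟩
    refine Subset.antisymm (closure_minimal (singleton_subset_iff.2 haC) hcl) fun c hcC => ?_
    refine (h c a).1 (h.le_of_forall_isOpen fun U hU hcU => ?_)
    obtain ⟨u, hu, huc⟩ := hc c U hU hcU
    exact h.isUpperSet hU (ha.1 ⟨c, hcC, huc⟩) hu

/-- A directed set is irreducible because open sets are upper sets. The generic point of its closure
is its supremum. -/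
lemma IsCompatible.isMcOrdered_of_isSober {s : TopologicalSpace X} (h : IsCompatible s)
    (hs : IsSober s) : IsMcOrdered s := fun D hD hd => by
  have hirr : IsIrreducible D := by
    refine ⟨hD, fun U V hU hV ⟨x, hx, hxU⟩ ⟨y, hy, hyV⟩ => ?_⟩
    obtain ⟨z, hz, hxz, hyz⟩ := hd x hx y hy
    exact ⟨z, hz, h.isUpperSet hU hxz hxU, h.isUpperSet hV hyz hyV⟩
  obtain ⟨a, ha⟩ := hs.2.sober hirr.closure isClosed_closure
  have hcl : closure D = Iic a := by
    rw [← ha.def]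
    exact Set.ext fun y => (h y a).symm
  refine ⟨a, ⟨fun d hdD => hcl.subset (subset_closure hdD), fun b hb => ?_⟩,
    tendsto_of_forall_exists_mem h fun U hU haU => ?_⟩
  · exact (closure_minimal hb (h.isClosed_Iic b) : closure D ⊆ Iic b) (hcl.ge self_mem_Iic)
  · obtain ⟨d, hdU, hdD⟩ := mem_closure_iff.1 (hcl.ge self_mem_Iic : a ∈ closure D) U hU haU
    exact ⟨d, hdD, hdU⟩

/-- The added open sets are no obstacle to convergence: the complement of `↑F` is a lower set, so if
it contains the supremum it contains the whole directed set. -/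
lemma IsCompatible.isMcOrdered_weakPatch {s : TopologicalSpace X} (h : IsCompatible s)
    (hm : IsMcOrdered s) : IsMcOrdered (weakPatch s) := fun D hD hd => by
  obtain ⟨a, ha, hl⟩ := hm D hD hd
  refine ⟨a, ha, ?_⟩
  rw [h.weakPatch_eq]
  intro N hN
  obtain ⟨U, hU, haU, F, -, haF, hUF⟩ := mem_nhds_inf_lower_iff.1 hN
  refine mem_map.2 (mem_of_superset (mem_map.1 (hl (hU.mem_nhds haU))) fun d hdU =>
    hUF ⟨hdU, fun hdF => haF ?_⟩)
  exact (upperClosure F).upper (ha.1 (Subtype.coe_prop d)) hdF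

/-! ### Scott spaces of continuous domains -/

lemma isOpen_scott_iff {O : Set X} : IsOpen[Topology.scott X univ] O ↔ IsUpperSet O ∧
    ∀ D : Set X, D.Nonempty → DirectedOn (· ≤ ·) D → ∀ a, IsLUB D a → a ∈ O →
      ∃ d ∈ D, d ∈ O := by
  rw [@Topology.IsScott.isOpen_iff_isUpperSet_and_dirSupInaccOn X univ _
    (Topology.scott X univ) O (@Topology.IsScott.mk X univ _ (Topology.scott X univ) rfl)]
  refine and_congr_right fun _ => ⟨fun H D hD hd a ha haO => ?_, fun H D _ hD hd a ha haO => ?_⟩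
  · exact H (mem_univ D) hD hd ha haO
  · exact H D hD hd a ha haO

lemma isCompatible_scott : IsCompatible (Topology.scott X univ) := fun x y => by
  rw [@Topology.IsScott.closure_singleton X _ (Topology.scott X univ) y
    (@Topology.IsScott.mk X univ _ (Topology.scott X univ) rfl)]
  rfl

lemma IsContinuousDomain.isMcOrdered_scott (h : IsContinuousDomain X) :
    IsMcOrdered (Topology.scott X univ) := fun D hD hd => by
  obtain ⟨a, ha⟩ := h.1 D hD hd
  exact ⟨a, ha, tendsto_of_forall_exists_mem isCompatible_scott fun U hU haU =>
    (isOpen_scott_iff.1 hU).2 D hD hd a ha haU⟩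

/-- The least ideal `I x` is the set of elements way below `x`, and `x` is its join. Interpolation
makes each set `{x | u ∈ I x}` Scott open. It lies inside `↑u`, so `↑u` is a neighborhood of every
such `x`. -/
lemma IsContinuousDomain.isCoreSpace_scott (h : IsContinuousDomain X) :
    IsCoreSpace (Topology.scott X univ) := by
  rw [isCompatible_scott.isCoreSpace_iff]
  choose I hI using h.2
  have hle : ∀ {x : X} (J : Order.Ideal X) {a : X}, IsLUB (J : Set X) a → x ≤ a → I x ≤ J :=
    fun {x} J a ha hxa => (hI x).2 ⟨a, ha, hxa⟩
  have hmono : ∀ {x y : X}, x ≤ y → I x ≤ I y := fun {x y} hxy => by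
    obtain ⟨a, ha, hya⟩ := (hI y).1
    exact hle (I y) ha (hxy.trans hya)
  have hlub_Iic : ∀ x : X, IsLUB ((Order.Ideal.principal x : Order.Ideal X) : Set X) x :=
    fun x => ⟨fun y hy => Order.Ideal.mem_principal.1 hy,
      fun b hb => hb (Order.Ideal.mem_principal.2 le_rfl)⟩
  have hbelow : ∀ {x u : X}, u ∈ I x → u ≤ x := fun {x u} hu =>
    Order.Ideal.mem_principal.1 (hle _ (hlub_Iic x) le_rfl hu)
  have hlub : ∀ x : X, IsLUB (I x : Set X) x := fun x => by
    obtain ⟨a, ha, hxa⟩ := (hI x).1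
    exact ⟨fun u hu => hbelow hu, fun b hb => hxa.trans (ha.2 hb)⟩
  have hinterp : ∀ {x u : X}, u ∈ I x → ∃ y ∈ I x, u ∈ I y := fun {x u} hu => by
    -- The union of the ideals `I y` over `y ∈ I x` is again an ideal with join `x`, so it contains
    -- the least one, `I x`.
    let J : Order.Ideal X :=
      { carrier := {u | ∃ y ∈ I x, u ∈ I y}
        lower' := fun a b hba ⟨y, hy, ha⟩ => ⟨y, hy, (I y).lower hba ha⟩
        nonempty' := by
          obtain ⟨y, hy⟩ := (I x).nonempty
          obtain ⟨u, hu⟩ := (I y).nonempty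
          exact ⟨u, y, hy, hu⟩
        directed' := by
          rintro a ⟨y, hy, ha⟩ b ⟨z, hz, hb⟩
          obtain ⟨w, hw, hyw, hzw⟩ := (I x).directed y hy z hz
          obtain ⟨c, hc, hac, hbc⟩ := (I w).directed a (hmono hyw ha) b (hmono hzw hb)
          exact ⟨c, ⟨w, hw, hc⟩, hac, hbc⟩ }
    have hJ : IsLUB (J : Set X) x := by
      refine ⟨fun a ⟨y, hy, ha⟩ => (hbelow ha).trans (hbelow hy), fun b hb => ?_⟩
      exact (hlub x).2 fun y hy => (hlub y).2 fun a ha => hb ⟨y, hy, ha⟩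
    exact hle J hJ le_rfl hu
  have hopen : ∀ u : X, IsOpen[Topology.scott X univ] {x | u ∈ I x} := fun u => by
    refine isOpen_scott_iff.2 ⟨fun x y hxy hx => hmono hxy hx, fun D hD hd a ha hua => ?_⟩
    obtain ⟨y, hy, huy⟩ := hinterp hua
    let J : Order.Ideal X :=
      { carrier := lowerClosure D
        lower' := (lowerClosure D).lower
        nonempty' := hD.mono subset_lowerClosure
        directed' := by
          rintro a ⟨d, hdD, had⟩ b ⟨e, heD, hbe⟩
          obtain ⟨f, hf, hdf, hef⟩ := hd d hdD e heD
          exact ⟨f, subset_lowerClosure hf, had.trans hdf, hbe.trans hef⟩ }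
    have hJ : IsLUB (J : Set X) a := by
      refine ⟨?_, fun b hb => ha.2 fun d hdD => hb (subset_lowerClosure hdD)⟩
      rintro b ⟨d, hdD, hbd⟩
      exact hbd.trans (ha.1 hdD)
    obtain ⟨d, hdD, hyd⟩ : ∃ d ∈ D, y ≤ d := hle J hJ le_rfl hy
    exact ⟨d, hdD, hmono hyd huy⟩
  intro x O hO hx
  obtain ⟨u, hu, huO⟩ := (isOpen_scott_iff.1 hO).2 (I x) (I x).nonempty (I x).directed x (hlub x) hx
  exact ⟨u, huO, mem_of_superset (@IsOpen.mem_nhds X (Topology.scott X univ) _ _ (hopen u) hu)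
    fun y hy => hbelow hy⟩

/-- The least ideal at `x` consists of all `u` with `↑u` a neighborhood of `x`: if an ideal has a
join above `x`, then `↑u` is a neighborhood of that join, so by convergence the ideal meets `↑u` and
contains `u`. -/
lemma IsCompatible.isScottSpaceOfContinuousDomain {s : TopologicalSpace X} (h : IsCompatible s)
    (hc : IsCoreSpace s) (hm : IsMcOrdered s) : IsScottSpaceOfContinuousDomain s := by
  rw [h.isCoreSpace_iff] at hc
  let I : X → Order.Ideal X := fun x =>
    { carrier := {u | Ici u ∈ 𝓝 x}
      lower' := fun a b hba ha => mem_of_superset ha (Ici_subset_Ici.2 hba)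
      nonempty' := by
        obtain ⟨u, -, hu⟩ := hc x univ isOpen_univ trivial
        exact ⟨u, hu⟩
      directed' := by
        intro u hu v hv
        obtain ⟨w, hw, hwx⟩ := hc x _ (isOpen_interior.inter isOpen_interior)
          ⟨mem_interior_iff_mem_nhds.2 hu, mem_interior_iff_mem_nhds.2 hv⟩
        exact ⟨w, hwx, interior_subset hw.1, interior_subset hw.2⟩ }
  have hI : ∀ x, IsLUB (I x : Set X) x := fun x => by
    refine ⟨fun u hu => mem_of_mem_nhds (show Ici u ∈ 𝓝 x from hu), fun b hb => ?_⟩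
    refine h.le_of_forall_isOpen fun U hU hx => ?_
    obtain ⟨u, huU, hu⟩ := hc x U hU hx
    exact h.isUpperSet hU (hb hu) huU
  refine ⟨⟨fun D hD hd => (hm D hD hd).imp fun a ha => ha.1, fun x =>
    ⟨I x, ⟨x, hI x, le_rfl⟩, ?_⟩⟩, le_antisymm ?_ ?_⟩
  · rintro J ⟨a, ha, hxa⟩ u hu
    obtain ⟨j, hj, huj⟩ := hm.exists_mem J.nonempty J.directed ha (h.mem_nhds_mono hu hxa)
    exact J.lower huj hj
  · intro O hO
    refine (@isOpen_iff_mem_nhds X s O).2 fun x hx => ?_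
    have hO' := isOpen_scott_iff.1 hO
    obtain ⟨u, hu, huO⟩ := hO'.2 (I x) (I x).nonempty (I x).directed x (hI x) hx
    exact mem_of_superset hu (hO'.1.Ici_subset huO)
  · intro O hO
    exact isOpen_scott_iff.2 ⟨h.isUpperSet hO, fun D hD hd a ha haO =>
      hm.exists_mem hD hd ha (hO.mem_nhds haO)⟩

lemma isScottSpaceOfContinuousDomain_iff {s : TopologicalSpace X} :
    IsScottSpaceOfContinuousDomain s ↔ IsCompatible s ∧ IsSober s ∧ IsCoreSpace s := by
  constructor
  · rintro ⟨hd, rfl⟩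
    exact ⟨isCompatible_scott, isCompatible_scott.isSober_of_isMcOrdered hd.isCoreSpace_scott
      hd.isMcOrdered_scott, hd.isCoreSpace_scott⟩
  · rintro ⟨h, hs, hc⟩
    exact h.isScottSpaceOfContinuousDomain hc (h.isMcOrdered_of_isSober hs)

lemma isLawsonSpaceOfContinuousDomain_iff {t : TopologicalSpace X} :
    IsLawsonSpaceOfContinuousDomain t ↔
      ∃ s : TopologicalSpace X, IsSober s ∧ IsCoreSpace s ∧ IsWeakPatchSpaceOf t s := by
  have heq : Topology.lawson X = weakPatch (Topology.scott X univ) := by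
    rw [isCompatible_scott.weakPatch_eq, inf_comm]
    rfl
  constructor
  · rintro ⟨hd, rfl⟩
    obtain ⟨h, hs, hc⟩ := isScottSpaceOfContinuousDomain_iff.1 ⟨hd, rfl⟩
    exact ⟨_, hs, hc, h, heq⟩
  · rintro ⟨s, hs, hc, h, rfl⟩
    obtain ⟨hd, rfl⟩ := isScottSpaceOfContinuousDomain_iff.2 ⟨h, hs, hc⟩
    exact ⟨hd, heq.symm⟩

/-! ### Fan spaces -/

lemma IsFanSpace.isCoreSpace_upperSpace {t : TopologicalSpace X} (h : IsFanSpace t) :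
    IsCoreSpace (upperSpace t) := by
  rw [h.2.1.isCompatible_upperSpace.isCoreSpace_iff]
  intro x O hO hx
  obtain ⟨_, ⟨hne, u, F, -, rfl⟩, hA, hAO⟩ := h.2.2 x O hO.1 hx
  obtain ⟨a, hua, haF⟩ := hne
  -- A nonempty fan contains its apex `u`: otherwise `u ∈ ↑F` would force `↑u ⊆ ↑F`.
  have huO : u ∈ O := hAO ⟨self_mem_Ici, fun huF => haF ((upperClosure F).upper hua huF)⟩
  refine ⟨u, huO, ?_⟩
  obtain ⟨G, hGA, hG, hxG⟩ := (@mem_nhds_iff X t x _).1 hA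
  refine (@mem_nhds_iff X (upperSpace t) x _).2 ⟨upperClosure G, ?_,
    ⟨h.1 G hG, (upperClosure G).upper⟩, subset_upperClosure hxG⟩
  rintro y ⟨g, hg, hgy⟩
  exact (hGA hg).1.trans hgy

/-- If an open `G` lies in a fan `↑u \ ↑F`, then so does `↑G \ ↑F`, and upward stability makes the
latter open in the patch of the upper space. -/
lemma IsFanSpace.weakPatch_upperSpace {t : TopologicalSpace X} (h : IsFanSpace t) :
    weakPatch (upperSpace t) = t := by
  have hc := h.isCoreSpace_upperSpace
  have hcomp := h.2.1.isCompatible_upperSpace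
  rw [hcomp.weakPatch_eq]
  apply le_antisymm
  · intro O hO
    refine (@isOpen_iff_mem_nhds X (upperSpace t ⊓ Topology.lower X) O).2 fun x hx => ?_
    obtain ⟨_, ⟨-, u, F, hF, rfl⟩, hA, hAO⟩ := h.2.2 x O hO hx
    obtain ⟨G, hGA, hG, hxG⟩ := (@mem_nhds_iff X t x _).1 hA
    refine mem_nhds_inf_lower_iff.2 ⟨upperClosure G,
      isOpen_upperSpace_iff.2 ⟨h.1 G hG, (upperClosure G).upper⟩,
      subset_upperClosure hxG, F, hF, (hGA hxG).2, ?_⟩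
    rintro y ⟨⟨g, hg, hgy⟩, hyF⟩
    exact hAO ⟨(hGA hg).1.trans hgy, hyF⟩
  · refine le_inf le_sup_left (le_generateFrom ?_)
    rintro _ ⟨x, rfl⟩
    exact (h.2.1.2 x).isOpen_compl

end Order

/-! ### Continuity of meets as a condition on neighborhoods -/

section Semilattice

variable {X : Type u} [SemilatticeInf X]

lemma IsTopologicalSemilattice.isSemitopological {t : TopologicalSpace X}
    (h : IsTopologicalSemilattice t) :
    IsSemitopological t := fun x => by
  have : ContinuousInf X := h
  fun_prop

/-- A point `y` lies in `↑G` exactly when `g ⊓ y ∈ G` for some `g ∈ G`, so `↑G` is a union of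
preimages of `G` under unary meets. -/
lemma IsSemitopological.isUpStable {t : TopologicalSpace X} (h : IsSemitopological t) :
    IsUpStable t := fun G hG => by
  have : (upperClosure G : Set X) = ⋃ g ∈ G, (fun y => g ⊓ y) ⁻¹' G := by
    ext y
    simp only [mem_iUnion, mem_preimage, exists_prop, SetLike.mem_coe, mem_upperClosure]
    constructor
    · rintro ⟨g, hg, hgy⟩
      exact ⟨g, hg, by rwa [inf_eq_left.2 hgy]⟩
    · rintro ⟨g, -, hgy⟩
      exact ⟨_, hgy, inf_le_right⟩
  rw [this]
  exact isOpen_biUnion fun g _ => hG.preimage (h g)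

lemma IsCompatible.isSemitopological_iff {s : TopologicalSpace X} (h : IsCompatible s) :
    IsSemitopological s ↔ IsWebSpace s := by
  rw [h.isWebSpace_iff]
  constructor
  · intro hs x O hO hx
    refine ⟨O ∩ (fun y => x ⊓ y) ⁻¹' O, ⟨⟨hx, by simpa using hx⟩, fun y hy => ?_⟩,
      (hO.inter (hO.preimage (hs x))).mem_nhds ⟨hx, by simpa using hx⟩, inter_subset_left⟩
    exact ⟨x ⊓ y, ⟨hy.2, by simpa using hy.2⟩, inf_le_left, inf_le_right⟩
  · intro hw x
    refine continuous_def.2 fun O hO => isOpen_iff_mem_nhds.2 fun y hy => ?_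
    obtain ⟨W, hW, hWy, hWO⟩ := hw (x ⊓ y) O hO hy
    -- A neighborhood of `x ⊓ y` is also one of `y`, because `x ⊓ y ≤ y` and open sets are upper
    -- sets.
    refine mem_of_superset (h.mem_nhds_mono hWy inf_le_right) fun z hz => ?_
    obtain ⟨w, hw, hw1, hw2⟩ := hW.2 z hz
    exact h.isUpperSet hO (le_inf (hw1.trans inf_le_left) hw2) (hWO hw)

lemma IsCompatible.isSTopological_iff {s : TopologicalSpace X} (h : IsCompatible s) :
    IsSTopological s ↔ IsWideWebSpace s := by
  rw [h.isWideWebSpace_iff]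
  constructor
  · intro hs x O hO hx
    obtain ⟨N, hN, hNx, hNO⟩ := hs.2 x O hO hx
    exact ⟨N, ⟨⟨x, mem_of_mem_nhds hNx⟩, fun a ha b hb =>
      ⟨a ⊓ b, hN ha hb, inf_le_left, inf_le_right⟩⟩, hNx, hNO⟩
  · intro hw
    refine ⟨⟨continuous_def.2 fun O hO => isOpen_iff_mem_nhds.2 fun p hp => ?_⟩,
      fun x O hO hx => ?_⟩
    · obtain ⟨D, hD, hDp, hDO⟩ := hw (p.1 ⊓ p.2) O hO hp
      rw [nhds_prod_eq]
      refine mem_of_superset (prod_mem_prod (h.mem_nhds_mono hDp inf_le_left)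
        (h.mem_nhds_mono hDp inf_le_right)) fun q hq => ?_
      obtain ⟨z, hz, h1, h2⟩ := hD.2 _ hq.1 _ hq.2
      exact h.isUpperSet hO (le_inf h1 h2) (hDO hz)
    · obtain ⟨D, hD, hDx, hDO⟩ := hw x O hO hx
      refine ⟨upperClosure D, ?_, mem_of_superset hDx subset_upperClosure, ?_⟩
      · rintro a ⟨d, hd, hda⟩ b ⟨e, he, heb⟩
        obtain ⟨z, hz, h1, h2⟩ := hD.2 _ hd _ he
        exact ⟨z, hz, le_inf (h1.trans hda) (h2.trans heb)⟩
      · rintro a ⟨d, hd, hda⟩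
        exact h.isUpperSet hO hda (hDO hd)

lemma IsCompatible.isCoreSpace_iff_locallyCompactSpace {s : TopologicalSpace X}
    (h : IsCompatible s) : IsCoreSpace s ↔ LocallyCompactSpace X ∧ IsSTopological s := by
  constructor
  · exact fun hc => ⟨h.locallyCompactSpace_of_isCoreSpace hc,
      h.isSTopological_iff.2 (h.isWideWebSpace_of_isCoreSpace hc)⟩
  · rintro ⟨hl, hs⟩
    rw [h.isSTopological_iff, h.isWideWebSpace_iff] at hs
    rw [h.isCoreSpace_iff]
    intro x O hO hx
    obtain ⟨K, hK, hKO, hKc⟩ := hl.local_compact_nhds x O (hO.mem_nhds hx)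
    obtain ⟨D, hD, hDx, hDK⟩ := hs x (interior K) isOpen_interior (mem_interior_iff_mem_nhds.2 hK)
    -- Compactness gives a lower bound `u` of `D` in `K`: the principal ideals of members of `D` are
    -- closed, and filteredness of `D ⊆ K` supplies the finite intersection property. Then `D ⊆ ↑u`,
    -- so `↑u` is a neighborhood of `x`.
    obtain ⟨u, huK, hu⟩ : (K ∩ ⋂ d : D, Iic d.1).Nonempty := by
      refine hKc.inter_iInter_nonempty _ (fun d => h.isClosed_Iic d.1) fun F => ?_
      obtain ⟨m, hm, hmF⟩ : ∃ m ∈ D, ∀ d ∈ F, m ≤ d.1 := by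
        classical
        induction F using Finset.induction_on with
        | empty => exact hD.1.imp fun m hm => ⟨hm, by simp⟩
        | insert d F _ ih =>
          obtain ⟨m, hm, hmF⟩ := ih
          obtain ⟨z, hz, h1, h2⟩ := hD.2 m hm d.1 d.2
          refine ⟨z, hz, fun e he => ?_⟩
          rcases Finset.mem_insert.1 he with rfl | he
          · exact h2
          · exact le_trans h1 (hmF e he)
      exact ⟨m, interior_subset (hDK hm), mem_iInter₂.2 hmF⟩
    exact ⟨u, hKO huK, mem_of_superset hDx fun d hd => mem_iInter.1 hu ⟨d, hd⟩⟩

lemma continuousInf_lower : @ContinuousInf X (Topology.lower X) _ := by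
  let := Topology.lower X
  refine ⟨continuous_generateFrom_iff.2 ?_⟩
  rintro _ ⟨x, rfl⟩
  have : (fun p : X × X => p.1 ⊓ p.2) ⁻¹' (Ici x)ᶜ =
      Prod.fst ⁻¹' (Ici x)ᶜ ∪ Prod.snd ⁻¹' (Ici x)ᶜ := by
    ext p
    simp [imp_iff_not_or]
  rw [this]
  exact ((isClosed_lower_Ici x).isOpen_compl.preimage continuous_fst).union
    ((isClosed_lower_Ici x).isOpen_compl.preimage continuous_snd)

lemma IsCompatible.isSemitopological_weakPatch {s : TopologicalSpace X} (h : IsCompatible s)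
    (hs : IsSemitopological s) : IsSemitopological (weakPatch s) := fun x => by
  rw [h.weakPatch_eq]
  refine continuous_inf_rng.2 ⟨continuous_inf_dom_left (hs x), continuous_inf_dom_right ?_⟩
  exact IsTopologicalSemilattice.isSemitopological continuousInf_lower x

lemma IsCompatible.isSTopological_weakPatch {s : TopologicalSpace X} (h : IsCompatible s)
    (hs : IsSTopological s) : IsSTopological (weakPatch s) := by
  rw [h.weakPatch_eq]
  refine ⟨?_, fun x O hO hx => ?_⟩
  · refine @ContinuousInf.mk X (s ⊓ Topology.lower X) _ (continuous_inf_rng.2 ⟨?_, ?_⟩)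
    · have := @ContinuousInf.continuous_inf X s _ hs.1
      exact continuous_inf_dom_left₂ this
    · have := @ContinuousInf.continuous_inf X (Topology.lower X) _ continuousInf_lower
      exact continuous_inf_dom_right₂ this
  · obtain ⟨U, hU, hxU, F, hF, hxF, hUF⟩ := mem_nhds_inf_lower_iff.1
      (@IsOpen.mem_nhds X (s ⊓ Topology.lower X) x O hO hx)
    obtain ⟨N, hN, hNx, hNU⟩ := hs.2 x U hU hxU
    -- Removing `↑F` leaves a subsemilattice, since its complement is a lower set.
    refine ⟨N \ (upperClosure F : Set X), ?_, ?_, (sdiff_subset_sdiff_left hNU).trans hUF⟩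
    · exact fun a ha b hb => ⟨hN ha.1 hb.1, fun hF =>
        ha.2 ((upperClosure F).upper inf_le_left hF)⟩
    · obtain ⟨V, hVN, hV, hxV⟩ := mem_nhds_iff.1 hNx
      exact mem_nhds_inf_lower_iff.2 ⟨V, hV, hxV, F, hF, hxF, sdiff_subset_sdiff_left hVN⟩

lemma IsSemitopological.upperSpace {t : TopologicalSpace X} (h : IsSemitopological t) :
    IsSemitopological (upperSpace t) := fun x =>
  (@continuous_def X X (SemilatSpace.upperSpace t) (SemilatSpace.upperSpace t) _).2 fun _ hU =>
    ⟨hU.1.preimage (h x), (isOpen_upperSpace_iff.1 hU).2.preimage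
      fun _ _ hab => inf_le_inf_left x hab⟩

lemma IsSTopological.upperSpace {t : TopologicalSpace X} (h : IsSTopological t)
    (h1 : IsT1Ordered t) : IsSTopological (upperSpace t) := by
  have hc := h1.isCompatible_upperSpace
  rw [hc.isSTopological_iff, hc.isWideWebSpace_iff]
  intro x O hO hx
  obtain ⟨N, hN, hNx, hNO⟩ := h.2 x O hO.1 hx
  obtain ⟨G, hGN, hG, hxG⟩ := (@mem_nhds_iff X t x _).1 hNx
  refine ⟨upperClosure N, ⟨⟨x, subset_upperClosure (hGN hxG)⟩, ?_⟩, ?_, ?_⟩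
  · rintro a ⟨d, hd, hda⟩ b ⟨e, he, heb⟩
    exact ⟨d ⊓ e, subset_upperClosure (hN hd he), inf_le_left.trans hda,
      inf_le_right.trans heb⟩
  · exact (@mem_nhds_iff X (SemilatSpace.upperSpace t) x _).2 ⟨upperClosure G,
      upperClosure_anti hGN, ⟨(IsTopologicalSemilattice.isSemitopological h.1).isUpStable G hG,
        (upperClosure G).upper⟩,
      subset_upperClosure hxG⟩
  · rintro a ⟨d, hd, hda⟩
    exact hO.2 hda (hNO hd)

lemma IsCompatible.isFanSpace_weakPatch {s : TopologicalSpace X} (h : IsCompatible s)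
    (hc : IsCoreSpace s) : IsFanSpace (weakPatch s) := by
  refine ⟨(h.isSemitopological_weakPatch (h.isSemitopological_iff.2
    (h.isWebSpace_of_isCoreSpace hc))).isUpStable, h.isT1Ordered_weakPatch, ?_⟩
  rw [h.isCoreSpace_iff] at hc
  rw [h.weakPatch_eq]
  intro x O hO hx
  obtain ⟨U, hU, hxU, F, hF, hxF, hUF⟩ := mem_nhds_inf_lower_iff.1
    (@IsOpen.mem_nhds X (s ⊓ Topology.lower X) x O hO hx)
  obtain ⟨u, huU, hu⟩ := hc x U hU hxU
  refine ⟨Ici u \ (upperClosure F : Set X), ⟨⟨x, mem_of_mem_nhds hu, hxF⟩, u, F, hF, rfl⟩, ?_,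
    (sdiff_subset_sdiff_left ((h.isUpperSet hU).Ici_subset huU)).trans hUF⟩
  obtain ⟨V, hVN, hV, hxV⟩ := mem_nhds_iff.1 hu
  exact mem_nhds_inf_lower_iff.2 ⟨V, hV, hxV, F, hF, hxF, sdiff_subset_sdiff_left hVN⟩

/-- The upper space is a core space, hence s-topological, and this passes to its patch, which is
`t`. -/
lemma IsFanSpace.isSTopological {t : TopologicalSpace X} (h : IsFanSpace t) :
    IsSTopological t := by
  have hc := h.2.1.isCompatible_upperSpace
  have := hc.isSTopological_weakPatch (hc.isSTopological_iff.2
    (hc.isWideWebSpace_of_isCoreSpace h.isCoreSpace_upperSpace))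
  rwa [h.weakPatch_upperSpace] at this

lemma exists_isWeakPatchSpaceOf_iff_isFanSpace {t : TopologicalSpace X} :
    (∃ s : TopologicalSpace X, IsSober s ∧ IsCoreSpace s ∧ IsWeakPatchSpaceOf t s) ↔
      IsMcOrdered t ∧ IsFanSpace t := by
  constructor
  · rintro ⟨s, hs, hc, h, rfl⟩
    exact ⟨h.isMcOrdered_weakPatch (h.isMcOrdered_of_isSober hs), h.isFanSpace_weakPatch hc⟩
  · rintro ⟨hm, hf⟩
    have h := hf.2.1.isCompatible_upperSpace
    exact ⟨upperSpace t, h.isSober_of_isMcOrdered hf.isCoreSpace_upperSpace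
      (hm.mono le_sup_left), hf.isCoreSpace_upperSpace, h, hf.weakPatch_upperSpace.symm⟩

lemma exists_isWeakPatchSpaceOf_iff_isHyperconvex {t : TopologicalSpace X} :
    (∃ s : TopologicalSpace X, IsSober s ∧ IsCoreSpace s ∧ IsWeakPatchSpaceOf t s) ↔
      IsHyperconvex t ∧ IsMcOrdered t ∧ IsSTopological t ∧ IsT1Ordered t ∧
        @LocallyCompactSpace X (upperSpace t) := by
  constructor
  · rintro ⟨s, hs, hc, h, rfl⟩
    refine ⟨h.isHyperconvex_weakPatch, h.isMcOrdered_weakPatch (h.isMcOrdered_of_isSober hs),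
      h.isSTopological_weakPatch (h.isSTopological_iff.2 (h.isWideWebSpace_of_isCoreSpace hc)),
      h.isT1Ordered_weakPatch, ?_⟩
    rw [h.upperSpace_weakPatch (h.isWebSpace_of_isCoreSpace hc)]
    exact h.locallyCompactSpace_of_isCoreSpace hc
  · rintro ⟨hh, hm, hs, h1, hl⟩
    have h := h1.isCompatible_upperSpace
    have hc := h.isCoreSpace_iff_locallyCompactSpace.2 ⟨hl, hs.upperSpace h1⟩
    exact ⟨upperSpace t, h.isSober_of_isMcOrdered hc (hm.mono le_sup_left), hc, h,
      (hh.weakPatch_upperSpace h1).symm⟩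

end Semilattice

/-- The upper space of a semilattice-ordered space. -/
def SLSpace.upper (S : SLSpace.{u}) : SLSpace.{u} :=
  ⟨S.carrier, S.semilattice, upperSpace S.top⟩

/-! ### Reduction of the categorical isomorphisms to objects and maps -/

namespace SLCat

variable {M : MapClass.{u}} {P : SLSpace.{u} → Prop}

lemma eq_of_top_eq {X : Type u} {L : SemilatticeInf X} {s t : TopologicalSpace X}
    (h : s = t) (hs : P ⟨X, L, s⟩) (ht : P ⟨X, L, t⟩) :
    (⟨⟨X, L, s⟩, hs⟩ : SLCat M P) = ⟨⟨X, L, t⟩, ht⟩ := by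
  subst h
  rfl

/-- The round trips return each topology only up to a proved equality, so comparing morphisms needs
transport along `eqToHom`. With the topologies as variables, substitution removes it. -/
lemma eq_eqToHom_comp_of_toFun_eq {X Y : Type u} {L : SemilatticeInf X} {K : SemilatticeInf Y}
    {s t : TopologicalSpace X} {s' t' : TopologicalSpace Y} (h : s = t) (h' : s' = t')
    {hs : P ⟨X, L, s⟩} {ht : P ⟨X, L, t⟩} {hs' : P ⟨Y, K, s'⟩} {ht' : P ⟨Y, K, t'⟩}
    (f : (⟨⟨X, L, s⟩, hs⟩ : SLCat M P) ⟶ ⟨⟨Y, K, s'⟩, hs'⟩)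
    (g : (⟨⟨X, L, t⟩, ht⟩ : SLCat M P) ⟶ ⟨⟨Y, K, t'⟩, ht'⟩)
    (hfg : (Hom.toFun f : X → Y) = Hom.toFun g) :
    f = eqToHom (eq_of_top_eq h hs ht) ≫ g ≫ eqToHom (eq_of_top_eq h'.symm ht' hs') := by
  subst h h'
  simpa using Hom.ext hfg

end SLCat

lemma inducesConcreteIso_of_mem {M N : MapClass.{u}} {P Q : SLSpace.{u} → Prop}
    (hP : ∀ S, P S → Q S.weakPatchSpace) (hQ : ∀ S, Q S → P S.upper)
    (hPQ : ∀ S, P S → upperSpace (weakPatch S.top) = S.top)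
    (hQP : ∀ S, Q S → weakPatch (upperSpace S.top) = S.top)
    (hM : ∀ (S T : SLSpace.{u}) (f : S.carrier → T.carrier), P S → P T → M.mem S T f →
      N.mem S.weakPatchSpace T.weakPatchSpace f)
    (hN : ∀ (S T : SLSpace.{u}) (f : S.carrier → T.carrier), Q S → Q T → N.mem S T f →
      M.mem S.upper T.upper f) :
    InducesConcreteIso M N P Q := by
  let F : SLCat M P ⥤ SLCat N Q :=
    { obj := fun A => ⟨A.space.weakPatchSpace, hP _ A.property⟩
      map := fun {A B} f => ⟨f.toFun, hM _ _ _ A.property B.property f.mem⟩ }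
  let G : SLCat N Q ⥤ SLCat M P :=
    { obj := fun A => ⟨A.space.upper, hQ _ A.property⟩
      map := fun {A B} f => ⟨f.toFun, hN _ _ _ A.property B.property f.mem⟩ }
  refine ⟨F, G, ?_, ?_, rfl, fun A => rfl⟩
  · refine CategoryTheory.Functor.ext
      (fun A => SLCat.eq_of_top_eq (hPQ _ A.property) _ A.property) fun A B f => ?_
    exact SLCat.eq_eqToHom_comp_of_toFun_eq (hPQ _ A.property) (hPQ _ B.property) _ f rfl
  · refine CategoryTheory.Functor.ext
      (fun A => SLCat.eq_of_top_eq (hQP _ A.property) _ A.property) fun A B f => ?_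
    exact SLCat.eq_eqToHom_comp_of_toFun_eq (hQP _ A.property) (hQP _ B.property) _ f rfl

/-! ### Transfer of morphisms -/

section Maps

variable {S T : SLSpace.{u}} {f : S.carrier → T.carrier}

lemma IsCompatible.monotone_of_continuous (hS : IsCompatible S.top) (hT : IsCompatible T.top)
    (hf : @Continuous _ _ S.top T.top f) : Monotone f := fun _ _ hxy =>
  hT.le_of_forall_isOpen fun U hU hx =>
    hS.isUpperSet (@IsOpen.preimage _ _ S.top T.top f hf U hU) hxy hx

/-- The web property of the target is what makes its patch-closed lower sets closed in the original
topology. -/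
lemma isotoneLSC_of_continuous (hS : IsCompatible S.top) (hT : IsCompatible T.top)
    (hw : IsWebSpace T.top) (hf : MapClass.continuous.mem S T f) :
    MapClass.isotoneLSC.mem S.weakPatchSpace T.weakPatchSpace f := by
  refine ⟨hS.monotone_of_continuous hT hf, fun C hC hl => ?_⟩
  have hC' : IsClosed[T.top] C := by
    rw [← hT.upperSpace_weakPatch hw]
    exact isClosed_upperSpace_iff.2 ⟨hC, hl⟩
  exact (@IsClosed.preimage _ _ S.top T.top f hf C hC').mono inf_le_left

/-- The two clauses of υ-properness are continuity from the patch into each of the two topologies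
whose join is the target patch. -/
lemma isotoneContinuous_of_proper (hS : IsCompatible S.top) (hT : IsCompatible T.top)
    (hf : MapClass.proper.mem S T f) :
    MapClass.isotoneContinuous.mem S.weakPatchSpace T.weakPatchSpace f :=
  ⟨hS.monotone_of_continuous hT hf.1, continuous_inf_rng.2 ⟨continuous_inf_dom_left hf.1,
    (@continuous_iff_isClosed _ _ (weakPatch S.top) (_) f).2 hf.2⟩⟩

lemma continuous_upper_of_isotoneLSC (hf : MapClass.isotoneLSC.mem S T f) :
    MapClass.continuous.mem S.upper T.upper f := by
  refine (@continuous_iff_isClosed _ _ (upperSpace S.top) (upperSpace T.top) f).2 fun C hC => ?_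
  have hC' := isClosed_upperSpace_iff.1 hC
  exact isClosed_upperSpace_iff.2 ⟨hf.2 C hC'.1 hC'.2, hC'.2.preimage hf.1⟩

lemma proper_upper_of_isotoneContinuous (hS : weakPatch (upperSpace S.top) = S.top)
    (hT : weakPatch (upperSpace T.top) = T.top) (hf : MapClass.isotoneContinuous.mem S T f) :
    MapClass.proper.mem S.upper T.upper f := by
  refine ⟨continuous_upper_of_isotoneLSC ⟨hf.1, fun C hC _ =>
    @IsClosed.preimage _ _ S.top T.top f hf.2 C hC⟩, fun C hC => ?_⟩
  change IsClosed[weakPatch (upperSpace S.top)] (f ⁻¹' C)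
  rw [hS]
  refine @IsClosed.preimage _ _ S.top T.top f hf.2 C ?_
  rw [← hT]
  exact hC.mono inf_le_right

end Maps

lemma weakPatchIso_of_forall {P Q : SLSpace.{u} → Prop}
    (hP : ∀ S, P S → IsCompatible S.top ∧ IsWebSpace S.top ∧ Q S.weakPatchSpace)
    (hQ : ∀ S, Q S → weakPatch (upperSpace S.top) = S.top ∧ P S.upper) : WeakPatchIso P Q := by
  have hPQ : ∀ S, P S → upperSpace (weakPatch S.top) = S.top := fun S hS =>
    (hP S hS).1.upperSpace_weakPatch (hP S hS).2.1
  refine ⟨?_, ?_, ?_, ?_⟩ <;>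
    refine inducesConcreteIso_of_mem (fun S hS => (hP S hS).2.2) (fun S hS => (hQ S hS).2) hPQ
      (fun S hS => (hQ S hS).1) (fun S T f hS hT hf => ?_) (fun S T f hS hT hf => ?_)
  · exact isotoneLSC_of_continuous (hP S hS).1 (hP T hT).1 (hP T hT).2.1 hf
  · exact continuous_upper_of_isotoneLSC hf
  · exact isotoneContinuous_of_proper (hP S hS).1 (hP T hT).1 hf
  · exact proper_upper_of_isotoneContinuous (hQ S hS).1 (hQ T hT).1 hf
  · exact ⟨isotoneLSC_of_continuous (hP S hS).1 (hP T hT).1 (hP T hT).2.1 hf.1, hf.2⟩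
  · exact ⟨continuous_upper_of_isotoneLSC hf.1, hf.2⟩
  · exact ⟨isotoneContinuous_of_proper (hP S hS).1 (hP T hT).1 hf.1, hf.2⟩
  · exact ⟨proper_upper_of_isotoneContinuous (hQ S hS).1 (hQ T hT).1 hf.1, hf.2⟩

lemma existsUnique_iff_exists_isWeakPatchSpaceOf {X : Type u} [SemilatticeInf X]
    {t : TopologicalSpace X} :
    (∃! s : TopologicalSpace X, IsSober s ∧ IsCoreSpace s ∧ IsWeakPatchSpaceOf t s) ↔
      ∃ s : TopologicalSpace X, IsSober s ∧ IsCoreSpace s ∧ IsWeakPatchSpaceOf t s := by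
  refine ⟨ExistsUnique.exists, fun ⟨s, hs⟩ => ⟨s, hs, ?_⟩⟩
  -- Uniqueness comes from an explicit formula for `s` in terms of `t` and the order.
  have key : ∀ s : TopologicalSpace X, IsCoreSpace s ∧ IsWeakPatchSpaceOf t s →
      s = upperSpace t := by
    rintro s ⟨hc, h, rfl⟩
    exact (h.upperSpace_weakPatch (h.isWebSpace_of_isCoreSpace hc)).symm
  exact fun r hr => (key r hr.2).trans (key s hs.2).symm

lemma isLawsonSpaceOfContinuousDomain_iff_isFanSpace {X : Type u} [SemilatticeInf X]
    {t : TopologicalSpace X} :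
    IsLawsonSpaceOfContinuousDomain t ↔ IsMcOrdered t ∧ IsFanSpace t :=
  isLawsonSpaceOfContinuousDomain_iff.trans exists_isWeakPatchSpaceOf_iff_isFanSpace

end SemilatSpace

theorem mainTheorem6 :
    -- the four characterizations
    (∀ S : SLSpace.{u}, List.TFAE [
      ∃! s : TopologicalSpace S.carrier,
        IsSober s ∧ IsCoreSpace s ∧ IsWeakPatchSpaceOf S.top s,
      ∃ s : TopologicalSpace S.carrier,
        IsSober s ∧ IsCoreSpace s ∧ IsWeakPatchSpaceOf S.top s,
      IsMcOrdered S.top ∧ IsFanSpace S.top,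
      IsHyperconvex S.top ∧ IsMcOrdered S.top ∧ IsSTopological S.top ∧ IsT1Ordered S.top ∧
        @LocallyCompactSpace S.carrier (upperSpace S.top),
      IsLawsonSpaceOfContinuousDomain S.top]) ∧
    -- the two descriptions of the first class in (1), (2), (3), and of both classes in (4)
    (∀ S : SLSpace.{u},
      ((IsCompatible S.top ∧ IsSemitopological S.top) ↔
        (IsCompatible S.top ∧ IsWebSpace S.top)) ∧
      ((IsCompatible S.top ∧ IsSTopological S.top) ↔
        (IsCompatible S.top ∧ IsWideWebSpace S.top)) ∧
      ((@LocallyCompactSpace S.carrier S.top ∧ IsCompatible S.top ∧ IsSTopological S.top) ↔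
        (IsCompatible S.top ∧ IsCoreSpace S.top)) ∧
      (IsScottSpaceOfContinuousDomain S.top ↔
        (IsCompatible S.top ∧ IsSober S.top ∧ IsCoreSpace S.top)) ∧
      (IsLawsonSpaceOfContinuousDomain S.top ↔
        (IsMcOrdered S.top ∧ IsTopologicalSemilattice S.top ∧ IsFanSpace S.top))) ∧
    -- (1)
    WeakPatchIso.{u}
      (fun S => IsCompatible S.top ∧ IsSemitopological S.top)
      (fun S => IsHyperconvex S.top ∧ IsSemitopological S.top ∧ IsT1Ordered S.top) ∧
    -- (2)
    WeakPatchIso.{u}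
      (fun S => IsCompatible S.top ∧ IsSTopological S.top)
      (fun S => IsHyperconvex S.top ∧ IsSTopological S.top ∧ IsT1Ordered S.top) ∧
    -- (3)
    WeakPatchIso.{u}
      (fun S => @LocallyCompactSpace S.carrier S.top ∧ IsCompatible S.top ∧
        IsSTopological S.top)
      (fun S => IsTopologicalSemilattice S.top ∧ IsFanSpace S.top) ∧
    -- (4)
    WeakPatchIso.{u}
      (fun S => IsScottSpaceOfContinuousDomain S.top)
      (fun S => IsLawsonSpaceOfContinuousDomain S.top) := by
  refine ⟨fun S => ?_, fun S => ⟨?_, ?_, ?_, isScottSpaceOfContinuousDomain_iff, ?_⟩,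
    weakPatchIso_of_forall ?_ ?_, weakPatchIso_of_forall ?_ ?_, weakPatchIso_of_forall ?_ ?_,
    weakPatchIso_of_forall ?_ ?_⟩
  · tfae_have 1 ↔ 2 := existsUnique_iff_exists_isWeakPatchSpaceOf
    tfae_have 2 ↔ 3 := exists_isWeakPatchSpaceOf_iff_isFanSpace
    tfae_have 2 ↔ 4 := exists_isWeakPatchSpaceOf_iff_isHyperconvex
    tfae_have 5 ↔ 2 := isLawsonSpaceOfContinuousDomain_iff
    tfae_finish
  · exact and_congr_right fun h => h.isSemitopological_iff
  · exact and_congr_right fun h => h.isSTopological_iff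
  · rw [and_left_comm]
    exact and_congr_right fun h => h.isCoreSpace_iff_locallyCompactSpace.symm
  · rw [isLawsonSpaceOfContinuousDomain_iff_isFanSpace]
    exact and_congr_right fun _ => ⟨fun h => ⟨h.isSTopological.1, h⟩, And.right⟩
  · rintro S ⟨h, hs⟩
    exact ⟨h, h.isSemitopological_iff.1 hs, h.isHyperconvex_weakPatch,
      h.isSemitopological_weakPatch hs, h.isT1Ordered_weakPatch⟩
  · rintro S ⟨hh, hs, h1⟩
    exact ⟨hh.weakPatch_upperSpace h1, h1.isCompatible_upperSpace, hs.upperSpace⟩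
  · rintro S ⟨h, hs⟩
    exact ⟨h, h.isWebSpace_of_isWideWebSpace (h.isSTopological_iff.1 hs),
      h.isHyperconvex_weakPatch, h.isSTopological_weakPatch hs, h.isT1Ordered_weakPatch⟩
  · rintro S ⟨hh, hs, h1⟩
    exact ⟨hh.weakPatch_upperSpace h1, h1.isCompatible_upperSpace, hs.upperSpace h1⟩
  · rintro S ⟨hl, h, hs⟩
    have hc := h.isCoreSpace_iff_locallyCompactSpace.2 ⟨hl, hs⟩
    exact ⟨h, h.isWebSpace_of_isCoreSpace hc, (h.isSTopological_weakPatch hs).1,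
      h.isFanSpace_weakPatch hc⟩
  · rintro S ⟨-, hf⟩
    have h := hf.2.1.isCompatible_upperSpace
    have hc := h.isCoreSpace_iff_locallyCompactSpace.1 hf.isCoreSpace_upperSpace
    exact ⟨hf.weakPatch_upperSpace, hc.1, h, hc.2⟩
  · intro S hS
    obtain ⟨h, hs, hc⟩ := isScottSpaceOfContinuousDomain_iff.1 hS
    exact ⟨h, h.isWebSpace_of_isCoreSpace hc,
      isLawsonSpaceOfContinuousDomain_iff.2 ⟨S.top, hs, hc, h, rfl⟩⟩
  · intro S hS
    obtain ⟨hm, hf⟩ := isLawsonSpaceOfContinuousDomain_iff_isFanSpace.1 hS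
    exact ⟨hf.weakPatch_upperSpace, hf.2.1.isCompatible_upperSpace.isScottSpaceOfContinuousDomain
      hf.isCoreSpace_upperSpace (hm.mono le_sup_left)⟩
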